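/- Let $\mathcal A,\mathcal B,\mathcal X,\mathcal Y$ be finite sets. A *2-player game* is a pair $(q,H)$ with $q$ a probability distribution on $\mathcal A\times\mathcal B$ and $H\colon\mathcal A\times\mathcal B\times\mathcal X\times\mathcal Y\to[0,\infty)$; it has *complete support* if $q(a,b)\neq 0$ for all $a,b$. A *strategy* is a tuple $\Gamma=(D,E,\{\{R_a^x\}_x\}_a,\{\{S_b^y\}_y\}_b,\gamma)$, where $D,E$ are finite-dimensional complex Hilbert spaces, $\{R_a^x\}_{x\in\mathcal X}$ is a positive operator valued measure on $D$ for each $a\in\mathcal A$, $\{S_b^y\}_{y\in\mathcal Y}$ is a positive operator valued measure on $E$ for each $b\in\mathcal B$, and $\gamma$ is a density operator on $D\otimes E$. Put $$\rho_{ab}^{xy}=\operatorname{Tr}_D\!\left[\sqrt{R_a^x\otimes S_b^y}\;\gamma\,\sqrt{R_a^x\otimes S_b^y}\right].$$ $\Gamma$ *allows perfect guessing* if for all $a,b,y$ and all $x\neq x'$ the operators $\rho_{ab}^{xy}$ and $\rho_{ab}^{x'y}$ have orthogonal supports. A *unitary embedding* of $\Gamma$ into $\overline\Gamma=(\overline D,\overline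 E,\{\{\overline R_a^x\}_x\}_a,\{\{\overline S_b^y\}_y\}_b,\overline\gamma)$ is a pair of linear isometries $i\colon D\to\overline D$, $j\colon E\to\overline E$ with $\overline\gamma=(i\otimes j)\gamma(i\otimes j)^*$, $R_a^x=i^*\overline R_a^x i$ and $S_b^y=j^*\overline S_b^y j$ for all $a,b,x,y$. If $D=D_1\otimes D_2$ and $R_a^x=G_a^x\otimes I$ for all $a,x$, then the strategy $(D_1,E,\{\{G_a^x\}_x\}_a,\{\{S_b^y\}_y\}_b,\operatorname{Tr}_{D_2}\gamma)$ is called a *partial trace* of $\Gamma$; partial traces on the second player's space $E$ are defined similarly. Two strategies $\Gamma,\Gamma'$ are *congruent* if there is a finite sequence of strategies $\Gamma=\Gamma_1,\dots,\Gamma_n=\Gamma'$ such that for each $k<n$ one of $\Gamma_k,\Gamma_{k+1}$ is a partial trace of the other, or one of them has a unitary embedding into the other. A strategy is *essentially classical* if it is congruent to a strategy whose state $\gamma$ commutes with $R_a^x\otimes I_E$ for all $a,x$. **Theorem.** If a strategy for a complete-support game allows perfect guessing, then it is essentially classical. -/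

import Mathlib

open scoped TensorProduct

namespace QGame

noncomputable section

section Operators

variable {V W : Type*}
  [NormedAddCommGroup V] [InnerProductSpace ℂ V] [FiniteDimensional ℂ V]
  [NormedAddCommGroup W] [InnerProductSpace ℂ W] [FiniteDimensional ℂ W]

/-- The positive square root of a positive semidefinite operator on a finite-dimensional
Hilbert space (given by the continuous functional calculus). -/
def opSqrt (T : V →ₗ[ℂ] V) : V →ₗ[ℂ] V :=
  haveI : CompleteSpace V := FiniteDimensional.complete ℂ V
  (CFC.sqrt (LinearMap.toContinuousLinearMap T)).toLinearMap

/-- The partial trace `Tr_W : L(V ⊗ W) → L(V)`, i.e. the linear map with `S ⊗ T ↦ Tr(T) • S`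
(every operator on `V ⊗ W` is a sum of operators `S ⊗ T`). -/
def traceRight : (V ⊗[ℂ] W →ₗ[ℂ] V ⊗[ℂ] W) →ₗ[ℂ] (V →ₗ[ℂ] V) :=
  (TensorProduct.rid ℂ (V →ₗ[ℂ] V)).toLinearMap ∘ₗ
    LinearMap.lTensor (V →ₗ[ℂ] V) (LinearMap.trace ℂ W) ∘ₗ
      (homTensorHomEquiv ℂ V W V W).symm.toLinearMap

/-- The partial trace `Tr_V : L(V ⊗ W) → L(W)`, i.e. the linear map with `S ⊗ T ↦ Tr(S) • T`. -/
def traceLeft : (V ⊗[ℂ] W →ₗ[ℂ] V ⊗[ℂ] W) →ₗ[ℂ] (W →ₗ[ℂ] W) :=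
  (TensorProduct.lid ℂ (W →ₗ[ℂ] W)).toLinearMap ∘ₗ
    LinearMap.rTensor (W →ₗ[ℂ] W) (LinearMap.trace ℂ V) ∘ₗ
      (homTensorHomEquiv ℂ V W V W).symm.toLinearMap

/-- A positive operator valued measure on `V` with outcomes in the finite set `X`. -/
structure IsPOVM {X : Type*} [Fintype X] (M : X → V →ₗ[ℂ] V) : Prop where
  isPositive : ∀ x, (M x).IsPositive
  sum_eq_one : ∑ x, M x = 1

/-- A density operator on `V`. -/
structure IsDensity (γ : V →ₗ[ℂ] V) : Prop where
  isPositive : γ.IsPositive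
  trace_eq_one : LinearMap.trace ℂ V γ = 1

/-- A family of positive semidefinite operators is perfectly distinguishable if the supports of
any two of its members are orthogonal. (The support of a positive semidefinite operator, the
orthogonal complement of its kernel, is its range.) -/
def PerfectlyDistinguishable {X : Type*} (χ : X → V →ₗ[ℂ] V) : Prop :=
  ∀ x x', x ≠ x' → LinearMap.range (χ x) ⟂ LinearMap.range (χ x')

end Operators

/-- A 2-player game: a probability distribution `q` on the pairs of inputs and a nonnegative
scoring function `H`. -/
structure Game (A B X Y : Type*) [Fintype A] [Fintype B] where
  q : A → B → ℝ
  q_nonneg : ∀ a b, 0 ≤ q a b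
  q_sum : ∑ a, ∑ b, q a b = 1
  H : A → B → X → Y → ℝ
  H_nonneg : ∀ a b x y, 0 ≤ H a b x y

/-- A game has complete support if every pair of inputs has nonzero probability. -/
def Game.CompleteSupport {A B X Y : Type*} [Fintype A] [Fintype B] (G : Game A B X Y) : Prop :=
  ∀ a b, G.q a b ≠ 0

universe u v

/-- A 2-player quantum strategy with input alphabets `A`, `B` and output alphabets `X`, `Y`:
finite-dimensional Hilbert spaces `D`, `E`, families of measurements `R a` on `D` and `S b` on `E`,
and a density operator `γ` on `D ⊗ E`. -/
structure Strategy (A B X Y : Type*) [Fintype X] [Fintype Y] where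
  D : Type u
  E : Type v
  [normD : NormedAddCommGroup D]
  [innerD : InnerProductSpace ℂ D]
  [finD : FiniteDimensional ℂ D]
  [normE : NormedAddCommGroup E]
  [innerE : InnerProductSpace ℂ E]
  [finE : FiniteDimensional ℂ E]
  R : A → X → D →ₗ[ℂ] D
  S : B → Y → E →ₗ[ℂ] E
  γ : D ⊗[ℂ] E →ₗ[ℂ] D ⊗[ℂ] E
  povmR : ∀ a, IsPOVM (R a)
  povmS : ∀ b, IsPOVM (S b)
  densityγ : IsDensity γ

attribute [instance] Strategy.normD Strategy.innerD Strategy.finD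
  Strategy.normE Strategy.innerE Strategy.finE

namespace Strategy

variable {A B X Y : Type*} [Fintype X] [Fintype Y]

/-- The second player states
`ρ_{ab}^{xy} = Tr_D [√(R_a^x ⊗ S_b^y) γ √(R_a^x ⊗ S_b^y)]`. -/
def secondPlayerState (Γ : Strategy.{u, v} A B X Y) (a : A) (b : B) (x : X) (y : Y) :
    Γ.E →ₗ[ℂ] Γ.E :=
  traceLeft (opSqrt (TensorProduct.map (Γ.R a x) (Γ.S b y)) ∘ₗ Γ.γ ∘ₗ
    opSqrt (TensorProduct.map (Γ.R a x) (Γ.S b y)))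

/-- The strategy allows perfect guessing by the second player: for all `a`, `b`, `y` the family
`{ρ_{ab}^{xy}}_x` is perfectly distinguishable. -/
def AllowsPerfectGuessing (Γ : Strategy.{u, v} A B X Y) : Prop :=
  ∀ a b y, PerfectlyDistinguishable fun x => Γ.secondPlayerState a b x y

/-- There is a unitary embedding of `Γ` into `Γ'`: isometries `i : D → D'`, `j : E → E'` with
`γ' = (i ⊗ j) γ (i ⊗ j)*`, `R_a^x = i* R'_a^x i` and `S_b^y = j* S'_b^y j`. -/
def Embeds (Γ Γ' : Strategy.{u, v} A B X Y) : Prop :=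
  ∃ (i : Γ.D →ₗᵢ[ℂ] Γ'.D) (j : Γ.E →ₗᵢ[ℂ] Γ'.E),
    Γ'.γ = TensorProduct.map i.toLinearMap j.toLinearMap ∘ₗ Γ.γ ∘ₗ
      LinearMap.adjoint (TensorProduct.map i.toLinearMap j.toLinearMap) ∧
    (∀ a x, Γ.R a x = LinearMap.adjoint i.toLinearMap ∘ₗ Γ'.R a x ∘ₗ i.toLinearMap) ∧
    (∀ b y, Γ.S b y = LinearMap.adjoint j.toLinearMap ∘ₗ Γ'.S b y ∘ₗ j.toLinearMap)

/-- `Γ'` is a partial trace of `Γ` on the first player's side: with `D = D' ⊗ D₂` and `E = E'`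
(under unitary identifications `e` and `f`) we have `R_a^x = R'_a^x ⊗ I`, `S_b^y = S'_b^y` and
`γ' = Tr_{D₂} γ`. -/
def IsPartialTraceFst (Γ Γ' : Strategy.{u, v} A B X Y) : Prop :=
  ∃ (D₂ : Type u) (_ : NormedAddCommGroup D₂) (_ : InnerProductSpace ℂ D₂)
    (_ : FiniteDimensional ℂ D₂) (e : Γ.D ≃ₗᵢ[ℂ] Γ'.D ⊗[ℂ] D₂) (f : Γ.E ≃ₗᵢ[ℂ] Γ'.E),
    (∀ a x, e.toLinearEquiv.conj (Γ.R a x) =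
      TensorProduct.map (Γ'.R a x) (LinearMap.id : D₂ →ₗ[ℂ] D₂)) ∧
    (∀ b y, f.toLinearEquiv.conj (Γ.S b y) = Γ'.S b y) ∧
    Γ'.γ = traceRight
      ((TensorProduct.congr e.toLinearEquiv f.toLinearEquiv ≪≫ₗ
        TensorProduct.rightComm ℂ Γ'.D D₂ Γ'.E).conj Γ.γ)

/-- `Γ'` is a partial trace of `Γ` on the second player's side: with `D = D'` and `E = E' ⊗ E₂`
(under unitary identifications `e` and `f`) we have `R_a^x = R'_a^x`, `S_b^y = S'_b^y ⊗ I` and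
`γ' = Tr_{E₂} γ`. -/
def IsPartialTraceSnd (Γ Γ' : Strategy.{u, v} A B X Y) : Prop :=
  ∃ (E₂ : Type v) (_ : NormedAddCommGroup E₂) (_ : InnerProductSpace ℂ E₂)
    (_ : FiniteDimensional ℂ E₂) (e : Γ.D ≃ₗᵢ[ℂ] Γ'.D) (f : Γ.E ≃ₗᵢ[ℂ] Γ'.E ⊗[ℂ] E₂),
    (∀ a x, e.toLinearEquiv.conj (Γ.R a x) = Γ'.R a x) ∧
    (∀ b y, f.toLinearEquiv.conj (Γ.S b y) =
      TensorProduct.map (Γ'.S b y) (LinearMap.id : E₂ →ₗ[ℂ] E₂)) ∧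
    Γ'.γ = traceRight
      ((TensorProduct.congr e.toLinearEquiv f.toLinearEquiv ≪≫ₗ
        (TensorProduct.assoc ℂ Γ'.D Γ'.E E₂).symm).conj Γ.γ)

/-- One step in a chain of congruences. -/
def Step (Γ Γ' : Strategy.{u, v} A B X Y) : Prop :=
  Embeds Γ Γ' ∨ IsPartialTraceFst Γ Γ' ∨ IsPartialTraceSnd Γ Γ'

/-- Two strategies are congruent if they are joined by a finite chain of strategies in which any
two consecutive members are related, in one direction or the other, by a unitary embedding or by
a partial trace. -/
def Congruent (Γ Γ' : Strategy.{u, v} A B X Y) : Prop :=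
  Relation.EqvGen Step Γ Γ'

/-- A strategy is essentially classical if it is congruent to one whose shared state `γ` commutes
with all measurement operators `R_a^x` (that is, `R_a^x ⊗ I`) of the first player. -/
def EssentiallyClassical (Γ : Strategy.{u, v} A B X Y) : Prop :=
  ∃ Γ' : Strategy.{u, v} A B X Y, Congruent Γ Γ' ∧
    ∀ a x, Commute Γ'.γ (TensorProduct.map (Γ'.R a x) (LinearMap.id : Γ'.E →ₗ[ℂ] Γ'.E))

end Strategy

end

end QGame

/-! Write `T a x` for the unnormalised state `Tr_D[(R_a^x ⊗ 1) γ]` that the second player holds when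
input `a` gives output `x`. Cyclicity of `Tr_D` turns the second player states into `√S · T a x ·
√S`, and orthogonality of their supports becomes `T a x * S b y * T a x' = 0` for `x ≠ x'`
(`conditionalState_mul`). Summing over `y` also gives `T a x * T a x' = 0`.

Restricting `E` to the support of `σ = Tr_D γ` makes `σ` invertible (`exists_embeds_injective`).
Then the operators `P a x = σ⁻¹ T a x` are projections that sum to one and commute with every `S b
y` (`exists_commuting_projections`). They predict the first player's output: `(R_a^x ⊗ P a x') γ =
0` for `x ≠ x'`, hence `(R_a^x ⊗ 1) γ = (1 ⊗ P a x) γ`.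

It remains to make the state commute with `1 ⊗ P a x`. This is done by a channel on `E` whose Kraus
operators `k l` lie in the commutant of the `S b y`, and which is invisible up to congruence: its
Stinespring isometry carries `S` to `S ⊗ 1`, and the ancilla is then traced out (`congruent_twirl`).
The `k l` come from a Hilbert-Schmidt orthonormal basis of the commutant, on which right
multiplication by `P a x` is a Hermitian matrix (`exists_kraus`). That symmetry makes the twirled
state commute with `R_a^x ⊗ 1` (`commute_twirl`). -/

open scoped TensorProduct ComplexOrder

namespace QGame

universe u v

/-! ### Square roots, tensor products and partial traces of operators. -/

section Operators

variable {V W W' : Type*}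
  [NormedAddCommGroup V] [InnerProductSpace ℂ V] [FiniteDimensional ℂ V]
  [NormedAddCommGroup W] [InnerProductSpace ℂ W] [FiniteDimensional ℂ W]
  [NormedAddCommGroup W'] [InnerProductSpace ℂ W'] [FiniteDimensional ℂ W']

theorem opSqrt_isPositive (T : V →ₗ[ℂ] V) : (opSqrt T).IsPositive := by
  have : CompleteSpace V := FiniteDimensional.complete ℂ V
  exact (ContinuousLinearMap.isPositive_toLinearMap_iff _).2
    ((ContinuousLinearMap.nonneg_iff_isPositive _).1 (CFC.sqrt_nonneg _))

theorem opSqrt_mul_self {T : V →ₗ[ℂ] V} (hT : T.IsPositive) : opSqrt T * opSqrt T = T := by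
  have : CompleteSpace V := FiniteDimensional.complete ℂ V
  have h : (0 : V →L[ℂ] V) ≤ LinearMap.toContinuousLinearMap T :=
    (ContinuousLinearMap.nonneg_iff_isPositive _).2
      ((LinearMap.isPositive_toContinuousLinearMap_iff T).2 hT)
  have := congrArg ContinuousLinearMap.toLinearMap (CFC.sqrt_mul_sqrt_self _ h)
  exact this

theorem opSqrt_unique {T Q : V →ₗ[ℂ] V} (hQ : Q.IsPositive) (h : Q * Q = T) :
    opSqrt T = Q := by
  have : CompleteSpace V := FiniteDimensional.complete ℂ V
  have hQ' : (0 : V →L[ℂ] V) ≤ LinearMap.toContinuousLinearMap Q :=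
    (ContinuousLinearMap.nonneg_iff_isPositive _).2
      ((LinearMap.isPositive_toContinuousLinearMap_iff Q).2 hQ)
  have : CFC.sqrt (LinearMap.toContinuousLinearMap T) = LinearMap.toContinuousLinearMap Q := by
    refine CFC.sqrt_unique ?_ hQ'
    subst h
    rfl
  unfold opSqrt
  rw [this]
  rfl

theorem star_opSqrt (T : V →ₗ[ℂ] V) : star (opSqrt T) = opSqrt T :=
  (opSqrt_isPositive T).isSelfAdjoint

theorem star_map (S : V →ₗ[ℂ] V) (T : W →ₗ[ℂ] W) :
    star (TensorProduct.map S T) = TensorProduct.map (star S) (star T) :=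
  TensorProduct.adjoint_map S T

theorem isPositive_mul_star_self (T : V →ₗ[ℂ] V) : (T * star T).IsPositive :=
  LinearMap.isPositive_self_comp_adjoint T

theorem IsPositive.mul_mul_star {T : V →ₗ[ℂ] V} (hT : T.IsPositive) (S : V →ₗ[ℂ] V) :
    (S * T * star S).IsPositive :=
  hT.conj_adjoint S

theorem isPositive_map {S : V →ₗ[ℂ] V} {T : W →ₗ[ℂ] W} (hS : S.IsPositive) (hT : T.IsPositive) :
    (TensorProduct.map S T).IsPositive := by
  have : TensorProduct.map S T = TensorProduct.map (opSqrt S) (opSqrt T) *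
      star (TensorProduct.map (opSqrt S) (opSqrt T)) := by
    rw [star_map, star_opSqrt, star_opSqrt, ← TensorProduct.map_mul, opSqrt_mul_self hS,
      opSqrt_mul_self hT]
  rw [this]
  exact isPositive_mul_star_self _

theorem opSqrt_map {S : V →ₗ[ℂ] V} {T : W →ₗ[ℂ] W} (hS : S.IsPositive) (hT : T.IsPositive) :
    opSqrt (TensorProduct.map S T) = TensorProduct.map (opSqrt S) (opSqrt T) := by
  refine opSqrt_unique (isPositive_map (opSqrt_isPositive S) (opSqrt_isPositive T)) ?_
  rw [← TensorProduct.map_mul, opSqrt_mul_self hS, opSqrt_mul_self hT]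

theorem eq_zero_of_mul_star_self {Z : V →ₗ[ℂ] V} (h : Z * star Z = 0) : Z = 0 := by
  have h1 : star Z = 0 := by
    ext v
    have h2 : inner ℂ (star Z v) (star Z v) = 0 := by
      have : inner ℂ (star Z v) (star Z v) = inner ℂ v ((Z * star Z) v) := by
        rw [LinearMap.star_eq_adjoint, LinearMap.adjoint_inner_left]
        rfl
      rw [this, h]
      simp
    simpa using h2
  simpa using congrArg star h1

theorem eq_zero_of_trace_mul_star_self {Z : V →ₗ[ℂ] V}
    (h : LinearMap.trace ℂ V (Z * star Z) = 0) : Z = 0 := by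
  have hp := isPositive_mul_star_self Z
  rw [LinearMap.trace_eq_sum_inner _ (stdOrthonormalBasis ℂ V)] at h
  rw [Finset.sum_eq_zero_iff_of_nonneg (fun i _ => hp.inner_nonneg_right _)] at h
  have h1 : star Z = 0 := by
    refine (stdOrthonormalBasis ℂ V).toBasis.ext fun i => ?_
    have h2 := h i (Finset.mem_univ i)
    have h3 : inner ℂ (star Z (stdOrthonormalBasis ℂ V i)) (star Z (stdOrthonormalBasis ℂ V i))
        = 0 := by
      rw [← h2]
      conv_lhs => rw [LinearMap.star_eq_adjoint, LinearMap.adjoint_inner_left]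
      rfl
    simpa using h3
  simpa using congrArg star h1

/-- If `A⋆A` and `B⋆B` have product zero, then so do `A` and `B⋆`. -/
theorem mul_star_eq_zero {A B : V →ₗ[ℂ] V} (h : star A * A * (star B * B) = 0) :
    A * star B = 0 := by
  -- With `Z = A B⋆`, the hypothesis is a factor of `(Z Z⋆)(Z Z⋆)⋆`. Definiteness, applied twice,
  -- then gives `Z = 0`.
  have h1 : (A * star B) * star (A * star B) * star ((A * star B) * star (A * star B)) = 0 := by
    have : (A * star B) * star (A * star B) * star ((A * star B) * star (A * star B)) =
        A * star B * B * (star A * A * (star B * B)) * star A := by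
      simp only [star_mul, star_star, mul_assoc]
    rw [this, h, mul_zero, zero_mul]
  exact eq_zero_of_mul_star_self (eq_zero_of_mul_star_self h1)

theorem traceLeft_map (S : V →ₗ[ℂ] V) (T : W →ₗ[ℂ] W) :
    traceLeft (TensorProduct.map S T) = LinearMap.trace ℂ V S • T := by
  have : (homTensorHomEquiv ℂ V W V W).symm (TensorProduct.map S T) = S ⊗ₜ T := by
    rw [LinearEquiv.symm_apply_eq, homTensorHomEquiv_apply, TensorProduct.homTensorHomMap_apply]
  simp [traceLeft, this]

theorem traceRight_map (S : V →ₗ[ℂ] V) (T : W →ₗ[ℂ] W) :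
    traceRight (TensorProduct.map S T) = LinearMap.trace ℂ W T • S := by
  have : (homTensorHomEquiv ℂ V W V W).symm (TensorProduct.map S T) = S ⊗ₜ T := by
    rw [LinearEquiv.symm_apply_eq, homTensorHomEquiv_apply, TensorProduct.homTensorHomMap_apply]
  simp [traceRight, this]

theorem induction_map {p : (V ⊗[ℂ] W →ₗ[ℂ] V ⊗[ℂ] W) → Prop} (h0 : p 0)
    (hadd : ∀ M N, p M → p N → p (M + N)) (hmap : ∀ S T, p (TensorProduct.map S T))
    (M : V ⊗[ℂ] W →ₗ[ℂ] V ⊗[ℂ] W) : p M := by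
  obtain ⟨m, rfl⟩ := (homTensorHomEquiv ℂ V W V W).surjective M
  induction m with
  | zero => simpa using h0
  | tmul S T =>
    rw [homTensorHomEquiv_apply, TensorProduct.homTensorHomMap_apply]
    exact hmap S T
  | add x y hx hy =>
    rw [map_add]
    exact hadd _ _ hx hy

theorem traceLeft_map_id_comp_comp (F : W →ₗ[ℂ] W') (G : W' →ₗ[ℂ] W)
    (M : V ⊗[ℂ] W →ₗ[ℂ] V ⊗[ℂ] W) :
    traceLeft (TensorProduct.map (LinearMap.id : V →ₗ[ℂ] V) F ∘ₗ M ∘ₗ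
      TensorProduct.map (LinearMap.id : V →ₗ[ℂ] V) G) = F ∘ₗ traceLeft M ∘ₗ G := by
  induction M using induction_map with
  | h0 => simp
  | hadd M N hM hN => simp only [LinearMap.add_comp, LinearMap.comp_add, map_add, hM, hN]
  | hmap S T =>
    simp only [← TensorProduct.map_comp, traceLeft_map, LinearMap.id_comp, LinearMap.comp_id,
      LinearMap.smul_comp, LinearMap.comp_smul]

theorem traceLeft_map_one_mul_comm (A : V →ₗ[ℂ] V) (M : V ⊗[ℂ] W →ₗ[ℂ] V ⊗[ℂ] W) :
    traceLeft (TensorProduct.map A (1 : W →ₗ[ℂ] W) * M) =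
      traceLeft (M * TensorProduct.map A (1 : W →ₗ[ℂ] W)) := by
  induction M using induction_map with
  | h0 => simp
  | hadd M N hM hN => simp only [add_mul, mul_add, map_add, hM, hN]
  | hmap S T =>
    simp only [← TensorProduct.map_mul, traceLeft_map, one_mul, mul_one]
    rw [LinearMap.trace_mul_comm]

theorem trace_traceLeft (M : V ⊗[ℂ] W →ₗ[ℂ] V ⊗[ℂ] W) :
    LinearMap.trace ℂ W (traceLeft M) = LinearMap.trace ℂ (V ⊗[ℂ] W) M := by
  induction M using induction_map with
  | h0 => simp
  | hadd M N hM hN => simp only [map_add, hM, hN]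
  | hmap S T => simp [traceLeft_map, LinearMap.trace_tensorProduct']

theorem inner_traceLeft (M : V ⊗[ℂ] W →ₗ[ℂ] V ⊗[ℂ] W) (v w : W) :
    inner ℂ v (traceLeft M w) = ∑ i, inner ℂ (stdOrthonormalBasis ℂ V i ⊗ₜ[ℂ] v)
      (M (stdOrthonormalBasis ℂ V i ⊗ₜ[ℂ] w)) := by
  induction M using induction_map with
  | h0 => simp
  | hadd M N hM hN =>
    simp only [map_add, LinearMap.add_apply, inner_add_right, hM, hN, Finset.sum_add_distrib]
  | hmap S T =>
    simp [traceLeft_map, LinearMap.trace_eq_sum_inner S (stdOrthonormalBasis ℂ V),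
      Finset.sum_mul]

theorem traceLeft_isPositive {M : V ⊗[ℂ] W →ₗ[ℂ] V ⊗[ℂ] W} (hM : M.IsPositive) :
    (traceLeft M).IsPositive := by
  rw [LinearMap.isPositive_iff]
  have key : ∀ v w, inner ℂ (traceLeft M v) w = inner ℂ v (traceLeft M w) := by
    intro v w
    rw [← inner_conj_symm, inner_traceLeft, inner_traceLeft, map_sum]
    refine Finset.sum_congr rfl fun i _ => ?_
    exact (inner_conj_symm (𝕜 := ℂ) (M (stdOrthonormalBasis ℂ V i ⊗ₜ[ℂ] v))
      (stdOrthonormalBasis ℂ V i ⊗ₜ[ℂ] w)).trans (hM.isSymmetric _ _)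
  refine ⟨key, fun v => ?_⟩
  rw [key, inner_traceLeft]
  exact Finset.sum_nonneg fun i _ => hM.inner_nonneg_right _

/-- `L γ L⋆ = (L √γ)(L √γ)⋆` and the trace is faithful on such operators, so already `L √γ = 0`. -/
theorem mul_eq_zero_of_trace {γ L : V →ₗ[ℂ] V} (hγ : γ.IsPositive)
    (h : LinearMap.trace ℂ V (L * γ * star L) = 0) : L * γ = 0 := by
  have h1 : L * opSqrt γ = 0 := by
    apply eq_zero_of_trace_mul_star_self
    have : L * opSqrt γ * star (L * opSqrt γ) = L * γ * star L := by
      rw [star_mul, star_opSqrt]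
      conv_rhs => rw [← opSqrt_mul_self hγ]
      simp only [mul_assoc]
    rw [this, h]
  rw [← opSqrt_mul_self hγ, ← mul_assoc, h1, zero_mul]

/-- An operator annihilates a positive operator as soon as the conjugate has vanishing partial
trace. -/
theorem mul_eq_zero_of_traceLeft {γ L : V ⊗[ℂ] W →ₗ[ℂ] V ⊗[ℂ] W} (hγ : γ.IsPositive)
    (h : traceLeft (L * γ * star L) = 0) : L * γ = 0 := by
  refine mul_eq_zero_of_trace hγ ?_
  have := trace_traceLeft (L * γ * star L)
  rw [h, map_zero] at this
  exact this.symm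

/-- A square root of the inverse of an injective positive operator. -/
theorem exists_inv_sqrt {c : V →ₗ[ℂ] V} (hc : c.IsPositive) (hinj : Function.Injective c) :
    ∃ d : V →ₗ[ℂ] V, star d = d ∧ d * c * d = 1 ∧ ∀ T, Commute c T → Commute d T := by
  have : CompleteSpace V := FiniteDimensional.complete ℂ V
  let C : V →L[ℂ] V := LinearMap.toContinuousLinearMap c
  have hC : IsStrictlyPositive C := by
    refine IsStrictlyPositive.iff_of_unital.2 ⟨(ContinuousLinearMap.nonneg_iff_isPositive _).2
      ((LinearMap.isPositive_toContinuousLinearMap_iff c).2 hc), ?_⟩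
    let e : V ≃L[ℂ] V := (LinearEquiv.ofInjectiveEndo c hinj).toContinuousLinearEquiv
    exact ⟨ContinuousLinearEquiv.toUnit e, rfl⟩
  let r : V →L[ℂ] V := C ^ (-(1 / 2) : ℝ)
  have hr : 0 ≤ r := CFC.rpow_nonneg
  have hrC : r * C * r = 1 := by
    have h1 : C = C ^ (1 / 2 : ℝ) * C ^ (1 / 2 : ℝ) := by
      rw [← CFC.rpow_add hC.isUnit, add_halves, CFC.rpow_one C hC.nonneg]
    have h2 : r * C ^ (1 / 2 : ℝ) = 1 := CFC.rpow_neg_mul_rpow _ hC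
    have h3 : C ^ (1 / 2 : ℝ) * r = 1 := CFC.rpow_mul_rpow_neg _ hC
    calc r * C * r = r * C ^ (1 / 2 : ℝ) * (C ^ (1 / 2 : ℝ) * r) := by
          conv_lhs => rw [h1]
          simp only [mul_assoc]
      _ = 1 := by rw [h2, h3, one_mul]
  refine ⟨r.toLinearMap, ?_, ?_, fun T hT => ?_⟩
  · exact LinearMap.IsPositive.isSelfAdjoint ((ContinuousLinearMap.isPositive_toLinearMap_iff _).2
      ((ContinuousLinearMap.nonneg_iff_isPositive _).1 hr))
  · exact congrArg ContinuousLinearMap.toLinearMap hrC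
  · have hCT : Commute C (LinearMap.toContinuousLinearMap T) := by
      ext v
      exact congrArg (fun f : V →ₗ[ℂ] V => f v) hT.eq
    have := hCT.cfc_nnreal (fun x => x ^ (-(1 / 2) : ℝ))
    exact congrArg ContinuousLinearMap.toLinearMap this.eq

end Operators

/-! ### Hilbert-Schmidt bases, Kraus operators in a commutant, and commuting projections. -/

section Kraus

variable {V : Type*} [NormedAddCommGroup V] [InnerProductSpace ℂ V] [FiniteDimensional ℂ V]

theorem trace_star_mul_nonneg (T : V →ₗ[ℂ] V) : 0 ≤ LinearMap.trace ℂ V (star T * T) := by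
  have := (isPositive_mul_star_self (star T)).trace_nonneg
  rwa [star_star] at this

theorem trace_star (T : V →ₗ[ℂ] V) :
    LinearMap.trace ℂ V (star T) = (starRingEnd ℂ) (LinearMap.trace ℂ V T) := by
  rw [LinearMap.trace_eq_sum_inner _ (stdOrthonormalBasis ℂ V),
    LinearMap.trace_eq_sum_inner _ (stdOrthonormalBasis ℂ V), map_sum]
  refine Finset.sum_congr rfl fun i _ => ?_
  rw [inner_conj_symm, LinearMap.star_eq_adjoint, LinearMap.adjoint_inner_right]

/-- The Hilbert-Schmidt inner product on operators. -/
@[reducible] noncomputable def hilbertSchmidtCore : InnerProductSpace.Core ℂ (V →ₗ[ℂ] V) where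
  inner S T := LinearMap.trace ℂ V (star S * T)
  conj_inner_symm S T := by
    rw [← trace_star, star_mul, star_star]
  re_inner_nonneg S := (Complex.le_def.1 (trace_star_mul_nonneg S)).1
  add_left S T U := by rw [star_add, add_mul, map_add]
  smul_left S T c := by rw [star_smul, smul_mul_assoc, map_smul]; rfl
  definite S h := by
    have := eq_zero_of_trace_mul_star_self (Z := star S) (by rwa [star_star])
    simpa using congrArg star this

/-- An orthonormal basis for the Hilbert-Schmidt inner product of a space of operators: right
multiplication by a self-adjoint operator acts on it by a Hermitian matrix. -/
theorem exists_hermitian_basis (N : Submodule ℂ (V →ₗ[ℂ] V)) :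
    ∃ (n : ℕ) (b : Fin n → V →ₗ[ℂ] V), (∀ i, b i ∈ N) ∧ N ≤ Submodule.span ℂ (Set.range b) ∧
      ∀ r : V →ₗ[ℂ] V, star r = r → (∀ T ∈ N, T * r ∈ N) →
        ∃ m : Fin n → Fin n → ℂ, (∀ i j, star (m i j) = m j i) ∧
          ∀ i, b i * r = ∑ j, m j i • b j := by
  -- These local instances make `stdOrthonormalBasis ℂ N` orthonormal for the Hilbert-Schmidt
  -- product rather than for any operator norm.
  let _ : NormedAddCommGroup (V →ₗ[ℂ] V) := hilbertSchmidtCore.toNormedAddCommGroup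
  let _ : InnerProductSpace ℂ (V →ₗ[ℂ] V) := InnerProductSpace.ofCore hilbertSchmidtCore.toCore
  let b := stdOrthonormalBasis ℂ N
  have hexp : ∀ T ∈ N, T = ∑ j, LinearMap.trace ℂ V (star (b j : V →ₗ[ℂ] V) * T) •
      (b j : V →ₗ[ℂ] V) := by
    intro T hT
    have := congrArg (Submodule.subtype N) (b.sum_repr' ⟨T, hT⟩)
    rw [map_sum] at this
    exact this.symm
  refine ⟨_, fun i => (b i : V →ₗ[ℂ] V), fun i => (b i).2, fun T hT => ?_, fun r hr hN => ?_⟩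
  · rw [hexp T hT]
    exact Submodule.sum_mem _ fun j _ =>
      Submodule.smul_mem _ _ (Submodule.subset_span (Set.mem_range_self j))
  -- The entries are `⟨b j, b i * r⟩`; cyclicity of the trace and `star r = r` make the matrix
  -- Hermitian.
  · refine ⟨fun j i => LinearMap.trace ℂ V (star (b j : V →ₗ[ℂ] V) * ((b i : V →ₗ[ℂ] V) * r)), fun i j => ?_,
      fun i => hexp _ (hN _ (b i).2)⟩
    have := trace_star (star (b i : V →ₗ[ℂ] V) * ((b j : V →ₗ[ℂ] V) * r))
    refine this.symm.trans ?_
    rw [star_mul, star_mul, star_star, hr, mul_assoc, LinearMap.trace_mul_comm, mul_assoc]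

/-- Kraus operators in the commutant of a self-adjoint family, whose twirl maps into the
commutant of the self-adjoint part of that commutant. -/
theorem exists_kraus {ι : Type*} (S : ι → V →ₗ[ℂ] V) (hS : ∀ i, star (S i) = S i) :
    ∃ (n : ℕ) (k : Fin n → V →ₗ[ℂ] V), (∀ l i, Commute (k l) (S i)) ∧
      ∑ l, star (k l) * k l = 1 ∧
      ∀ P : V →ₗ[ℂ] V, star P = P → (∀ i, Commute P (S i)) →
        ∃ m : Fin n → Fin n → ℂ, (∀ i j, star (m i j) = m j i) ∧
          ∀ i, k i * P = ∑ j, m j i • k j := by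
  let N : Submodule ℂ (V →ₗ[ℂ] V) :=
    { carrier := {T | ∀ i, Commute T (S i)}
      add_mem' := fun hT hU i => (hT i).add_left (hU i)
      zero_mem' := fun i => Commute.zero_left _
      smul_mem' := fun c T hT i => (hT i).smul_left c }
  obtain ⟨n, b, hbN, hspan, hb⟩ := exists_hermitian_basis N
  have hbS : ∀ l i, Commute (b l) (S i) := fun l => hbN l
  set c : V →ₗ[ℂ] V := ∑ l, star (b l) * b l with hc_def
  -- The commutant is closed under `star` because each `S i` is self-adjoint.
  have hcS : ∀ i, Commute c (S i) := fun i => Commute.sum_left _ _ _ fun l _ => by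
    have := (hbS l i).star_star
    rw [hS] at this
    exact this.mul_left (hbS l i)
  have hcpos : c.IsPositive := LinearMap.isPositive_sum _ fun l _ => by
    have := isPositive_mul_star_self (star (b l))
    rwa [star_star] at this
  -- If `c v = 0` then every `b l` kills `v`. The identity lies in the commutant, hence in the span
  -- of the `b l`, so it kills `v` too.
  have hinj : Function.Injective c := by
    rw [← LinearMap.ker_eq_bot, LinearMap.ker_eq_bot']
    intro v hv
    have hsum : ∑ l, inner ℂ (b l v) (b l v) = 0 := by
      have h1 : inner ℂ v (c v) = ∑ l, inner ℂ (b l v) (b l v) := by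
        rw [hc_def, LinearMap.sum_apply, inner_sum]
        refine Finset.sum_congr rfl fun l _ => ?_
        exact LinearMap.adjoint_inner_right (b l) v (b l v)
      rw [← h1, hv, inner_zero_right]
    have hbv : ∀ l, b l v = 0 := by
      intro l
      have := (Finset.sum_eq_zero_iff_of_nonneg
        (fun l _ => LinearMap.isPositive_one.inner_nonneg_right (b l v))).1 hsum l (Finset.mem_univ l)
      simpa using this
    have h1 : (1 : V →ₗ[ℂ] V) ∈ Submodule.span ℂ (Set.range b) :=
      hspan fun i => Commute.one_left _
    have h2 : Submodule.span ℂ (Set.range b) ≤ LinearMap.ker (LinearMap.applyₗ (R := ℂ) v) := by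
      rw [Submodule.span_le]
      rintro _ ⟨l, rfl⟩
      exact hbv l
    exact h2 h1
  obtain ⟨d, hd, hdc, hcomm⟩ := exists_inv_sqrt hcpos hinj
  -- Right multiplication by `d = c^(-1/2)` normalises the basis: `d c d = 1`.
  refine ⟨n, fun l => b l * d, fun l i => (hbS l i).mul_left (hcomm _ (hcS i)), ?_,
    fun P hP hPS => ?_⟩
  · rw [← hdc, hc_def, Finset.mul_sum, Finset.sum_mul]
    refine Finset.sum_congr rfl fun l _ => ?_
    rw [star_mul, hd]
    simp only [mul_assoc]
  · obtain ⟨m, hm, hbP⟩ := hb P hP fun T hT i => (hT i).mul_left (hPS i)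
    -- Hermiticity of `m` makes `c P` and `P c` the same double sum with the indices exchanged.
    -- Hence `d` commutes with `P`, and the matrix relation passes from `b i` to `b i * d`.
    have hcP : Commute c P := by
      change c * P = P * c
      have h1 : ∀ l, P * star (b l) = ∑ j, m l j • star (b j) := fun l => by
        have := congrArg star (hbP l)
        rw [star_mul, hP, star_sum] at this
        simpa only [star_smul, hm] using this
      simp only [hc_def, Finset.sum_mul, Finset.mul_sum]
      simp only [← mul_assoc P, h1, mul_assoc _ _ P, hbP, Finset.sum_mul, Finset.mul_sum,
        smul_mul_assoc, mul_smul_comm]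
      exact Finset.sum_comm
    refine ⟨m, hm, fun i => ?_⟩
    rw [mul_assoc, (hcomm P hcP).eq, ← mul_assoc, hbP, Finset.sum_mul]
    simp only [smul_mul_assoc]

/-- Take `P x = σ⁻¹ T x` with `σ = ∑ x, T x`. Orthogonality makes each `T x` commute with `σ`, so `P
x` is self-adjoint and `P x * S i * P x' = 0` off the diagonal. Inserting `∑ x, P x = 1` on either
side shows that `P x * S i` and `S i * P x` both equal `P x * S i * P x`. -/
theorem exists_commuting_projections {X ι : Type*} [Fintype X] (T : X → V →ₗ[ℂ] V)
    (hT : ∀ x, star (T x) = T x) (hinj : Function.Injective (∑ x, T x : V →ₗ[ℂ] V))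
    (horth : ∀ x x', x ≠ x' → T x * T x' = 0)
    (S : ι → V →ₗ[ℂ] V) (hTS : ∀ i x x', x ≠ x' → T x * S i * T x' = 0) :
    ∃ P : X → V →ₗ[ℂ] V, (∀ x, star (P x) = P x) ∧ (∀ x i, Commute (P x) (S i)) ∧
      ∑ x, P x = 1 ∧ ∀ x x', x ≠ x' → P x' * T x = 0 := by
  classical
  set σ : V →ₗ[ℂ] V := ∑ x, T x with hσ
  obtain ⟨u, hu⟩ : IsUnit σ := ⟨LinearMap.GeneralLinearGroup.ofLinearEquiv
    (LinearEquiv.ofInjectiveEndo σ hinj), rfl⟩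
  set w : V →ₗ[ℂ] V := ((u⁻¹ : (Module.End ℂ V)ˣ) : Module.End ℂ V) with hw
  have hwσ : w * σ = 1 := by rw [hw, ← hu]; exact u.inv_mul
  have hσw : σ * w = 1 := by rw [hw, ← hu]; exact u.mul_inv
  have hTσ : ∀ x, T x * σ = T x * T x := fun x => by
    rw [hσ, Finset.mul_sum, Finset.sum_eq_single x]
    · exact fun x' _ h => horth x x' h.symm
    · simp
  have hσT : ∀ x, σ * T x = T x * T x := fun x => by
    rw [hσ, Finset.sum_mul, Finset.sum_eq_single x]
    · exact fun x' _ h => horth x' x h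
    · simp
  have hTw : ∀ x, T x * w = w * T x := fun x => by
    calc T x * w = w * σ * T x * w := by rw [hwσ, one_mul]
      _ = w * (T x * σ) * w := by rw [mul_assoc w, hσT, hTσ]
      _ = w * T x := by rw [mul_assoc, mul_assoc, hσw, mul_one]
  have hσs : star σ = σ := by rw [hσ, star_sum]; simp only [hT]
  have hws : star w = w := by
    have h1 : star w * σ = 1 := by
      have := congrArg star hσw
      rwa [star_mul, hσs, star_one] at this
    calc star w = star w * (σ * w) := by rw [hσw, mul_one]
      _ = w := by rw [← mul_assoc, h1, one_mul]
  have hsum : ∑ x, w * T x = 1 := by rw [← Finset.mul_sum, ← hσ, hwσ]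
  have hPSP : ∀ x x' i, x ≠ x' → w * T x * S i * (w * T x') = 0 := fun x x' i h => by
    calc w * T x * S i * (w * T x') = w * (T x * S i * T x') * w := by
          rw [← hTw x']; simp only [mul_assoc]
      _ = 0 := by rw [hTS i x x' h, mul_zero, zero_mul]
  refine ⟨fun x => w * T x, fun x => ?_, fun x i => ?_, hsum, fun x x' h => ?_⟩
  · rw [star_mul, hT, hws, hTw]
  · have h1 : w * T x * S i = w * T x * S i * (w * T x) := by
      conv_lhs => rw [← mul_one (w * T x * S i), ← hsum, Finset.mul_sum]
      rw [Finset.sum_eq_single x]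
      · exact fun x' _ h => hPSP x x' i h.symm
      · simp
    have h2 : S i * (w * T x) = w * T x * S i * (w * T x) := by
      conv_lhs => rw [← one_mul (S i * (w * T x)), ← hsum, Finset.sum_mul]
      rw [Finset.sum_eq_single x]
      · rw [mul_assoc (w * T x)]
      · intro x' _ h
        rw [← mul_assoc]
        exact hPSP x' x i h
      · simp
    exact h1.trans h2.symm
  · rw [mul_assoc, horth x' x h.symm, mul_zero]

end Kraus

theorem adjoint_map_id {V W W' : Type*}
    [NormedAddCommGroup V] [InnerProductSpace ℂ V] [FiniteDimensional ℂ V]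
    [NormedAddCommGroup W] [InnerProductSpace ℂ W] [FiniteDimensional ℂ W]
    [NormedAddCommGroup W'] [InnerProductSpace ℂ W'] [FiniteDimensional ℂ W'] (F : W →ₗ[ℂ] W') :
    LinearMap.adjoint (TensorProduct.map (LinearMap.id : V →ₗ[ℂ] V) F) =
      TensorProduct.map (LinearMap.id : V →ₗ[ℂ] V) (LinearMap.adjoint F) := by
  rw [TensorProduct.adjoint_map, LinearMap.adjoint_id]

theorem map_sum_left {V W ι : Type*} [AddCommGroup V] [Module ℂ V] [AddCommGroup W] [Module ℂ W]
    (s : Finset ι) (M : ι → V →ₗ[ℂ] V) (F : W →ₗ[ℂ] W) :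
    TensorProduct.map (∑ i ∈ s, M i) F = ∑ i ∈ s, TensorProduct.map (M i) F :=
  map_sum ((TensorProduct.mapBilinear (RingHom.id ℂ) V W V W).flip F) M s

theorem map_sum_right {V W ι : Type*} [AddCommGroup V] [Module ℂ V] [AddCommGroup W] [Module ℂ W]
    (s : Finset ι) (F : V →ₗ[ℂ] V) (M : ι → W →ₗ[ℂ] W) :
    TensorProduct.map F (∑ i ∈ s, M i) = ∑ i ∈ s, TensorProduct.map F (M i) :=
  map_sum (TensorProduct.mapBilinear (RingHom.id ℂ) V W V W F) M s

/-! ### Stinespring isometries built from Kraus operators; conjugation of states and measurements.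
-/

section Slices

variable {V W K : Type*}
  [NormedAddCommGroup V] [InnerProductSpace ℂ V] [FiniteDimensional ℂ V]
  [NormedAddCommGroup W] [InnerProductSpace ℂ W] [FiniteDimensional ℂ W]
  [NormedAddCommGroup K] [InnerProductSpace ℂ K] [FiniteDimensional ℂ K]

/-- Tensoring on the right with a fixed vector. -/
noncomputable def tensorVec (w : K) : V →ₗ[ℂ] V ⊗[ℂ] K := (TensorProduct.mk ℂ V K).flip w

/-- Contracting the right tensor factor with a fixed vector. -/
noncomputable def contractVec (w : K) : V ⊗[ℂ] K →ₗ[ℂ] V :=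
  (TensorProduct.rid ℂ V).toLinearMap ∘ₗ LinearMap.lTensor V (innerₛₗ ℂ w)

@[simp] theorem tensorVec_apply (w : K) (v : V) : tensorVec w v = v ⊗ₜ[ℂ] w := rfl

@[simp] theorem contractVec_tmul (w u : K) (v : V) :
    contractVec w (v ⊗ₜ[ℂ] u) = inner ℂ w u • v := by
  simp [contractVec]

theorem adjoint_tensorVec (w : K) :
    LinearMap.adjoint (tensorVec (V := V) w) = contractVec w := by
  symm
  rw [LinearMap.eq_adjoint_iff]
  intro x v
  induction x with
  | zero => simp
  | tmul a b => simp [inner_smul_left, mul_comm]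
  | add x y hx hy => rw [map_add, inner_add_left, inner_add_left, hx, hy]

theorem traceRight_tensorVec_contractVec (M : V →ₗ[ℂ] V) (w w' : K) :
    traceRight (tensorVec w ∘ₗ M ∘ₗ contractVec w') = inner ℂ w' w • M := by
  have h : tensorVec w ∘ₗ M ∘ₗ contractVec w' =
      TensorProduct.map M (InnerProductSpace.rankOne ℂ w w').toLinearMap := by
    refine TensorProduct.ext' fun v u => ?_
    simp [TensorProduct.smul_tmul']
  rw [h, traceRight_map, InnerProductSpace.trace_rankOne]

/-- The linear map `v ↦ ∑ l, k l v ⊗ e l` of a family of Kraus operators. -/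
noncomputable def krausMap {n : ℕ} (k : Fin n → V →ₗ[ℂ] V) (e : Fin n → K) : V →ₗ[ℂ] V ⊗[ℂ] K :=
  ∑ l, tensorVec (e l) ∘ₗ k l

theorem adjoint_krausMap {n : ℕ} (k : Fin n → V →ₗ[ℂ] V) (e : Fin n → K) :
    LinearMap.adjoint (krausMap k e) = ∑ l, star (k l) ∘ₗ contractVec (e l) := by
  rw [krausMap, map_sum]
  refine Finset.sum_congr rfl fun l _ => ?_
  rw [LinearMap.adjoint_comp, adjoint_tensorVec]
  rfl

/-- Orthonormality leaves the diagonal sum `∑ l, k l⋆ S (k l)`, and commutation turns it into `(∑ l,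
k l⋆ k l) S = S`. The case `S = id` says that the Kraus map is an isometry; the general case says
that the dilated measurement `S ⊗ 1` compresses back to `S`. -/
theorem adjoint_krausMap_comp {n : ℕ} {k : Fin n → V →ₗ[ℂ] V} {e : Fin n → K}
    (he : Orthonormal ℂ e) (hk : ∑ l, star (k l) * k l = 1) {S : V →ₗ[ℂ] V}
    (hS : ∀ l, Commute (k l) S) :
    LinearMap.adjoint (krausMap k e) ∘ₗ TensorProduct.map S LinearMap.id ∘ₗ krausMap k e = S := by
  ext v
  have h : ∀ l, (star (k l) ∘ₗ contractVec (e l)) (TensorProduct.map S LinearMap.id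
      (krausMap k e v)) = (star (k l) * k l) (S v) := by
    intro l
    have hl : ∀ w, k l (S w) = S (k l w) := fun w => congrArg (fun f : V →ₗ[ℂ] V => f w) (hS l).eq
    simp [krausMap, LinearMap.sum_apply, orthonormal_iff_ite.1 he, hl, apply_ite]
  rw [adjoint_krausMap, LinearMap.comp_apply, LinearMap.comp_apply, LinearMap.sum_apply,
    Finset.sum_congr rfl fun l _ => h l, ← LinearMap.sum_apply, hk]
  rfl

/-- The isometry given by a normalised family of Kraus operators. -/
noncomputable def krausIsometry {n : ℕ} {k : Fin n → V →ₗ[ℂ] V} {e : Fin n → K}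
    (he : Orthonormal ℂ e) (hk : ∑ l, star (k l) * k l = 1) : V →ₗᵢ[ℂ] V ⊗[ℂ] K :=
  (krausMap k e).isometryOfInner fun u v => by
    have h := adjoint_krausMap_comp he hk (S := LinearMap.id) fun l => Commute.one_right _
    rw [← LinearMap.adjoint_inner_right]
    have h2 := congrArg (fun f : V →ₗ[ℂ] V => inner ℂ u (f v)) h
    simpa [TensorProduct.map_id] using h2

theorem IsDensity.conj_isometry {γ : V →ₗ[ℂ] V} (hγ : IsDensity γ) {A : V →ₗ[ℂ] W}
    {A' : W →ₗ[ℂ] V} (hA' : LinearMap.adjoint A = A') (hA : A' ∘ₗ A = LinearMap.id) :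
    IsDensity (A ∘ₗ γ ∘ₗ A') := by
  subst hA'
  refine ⟨hγ.isPositive.conj_adjoint A, ?_⟩
  rw [LinearMap.trace_comp_comm', LinearMap.comp_assoc, hA, LinearMap.comp_id, hγ.trace_eq_one]

/-- The adjoint of the hypothesis is `γ A A⋆ = γ`, so `A A⋆` is absorbed on both sides: compressing
a state to a space that carries it loses nothing. -/
theorem conj_adjoint_of_comp_eq {γ : V →ₗ[ℂ] V} (hγ : γ.IsPositive) {A : W →ₗ[ℂ] V}
    {A' : V →ₗ[ℂ] W} (hA' : LinearMap.adjoint A = A') (h : A ∘ₗ A' ∘ₗ γ = γ) :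
    A ∘ₗ (A' ∘ₗ γ ∘ₗ A) ∘ₗ A' = γ := by
  subst hA'
  have h2 := congrArg LinearMap.adjoint h
  rw [LinearMap.adjoint_comp, LinearMap.adjoint_comp, LinearMap.adjoint_adjoint,
    hγ.adjoint_eq] at h2
  rw [LinearMap.comp_assoc, LinearMap.comp_assoc] at *
  rw [h2, h]

theorem IsDensity.conj_adjoint_of_comp_eq {γ : V →ₗ[ℂ] V} (hγ : IsDensity γ) {A : W →ₗ[ℂ] V}
    {A' : V →ₗ[ℂ] W} (hA' : LinearMap.adjoint A = A') (h : A ∘ₗ A' ∘ₗ γ = γ) :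
    IsDensity (A' ∘ₗ γ ∘ₗ A) := by
  subst hA'
  refine ⟨hγ.isPositive.adjoint_conj A, ?_⟩
  rw [← LinearMap.comp_assoc, LinearMap.trace_comp_comm', h, hγ.trace_eq_one]

theorem IsDensity.sum_kraus {n : ℕ} {γ : V →ₗ[ℂ] V} (hγ : IsDensity γ)
    {k : Fin n → V →ₗ[ℂ] V} (hk : ∑ l, star (k l) * k l = 1) :
    IsDensity (∑ l, k l * γ * star (k l)) := by
  refine ⟨LinearMap.isPositive_sum _ fun l _ => IsPositive.mul_mul_star hγ.isPositive _, ?_⟩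
  rw [map_sum]
  have : ∀ l, LinearMap.trace ℂ V (k l * γ * star (k l)) =
      LinearMap.trace ℂ V (star (k l) * k l * γ) := fun l => by
    rw [LinearMap.trace_mul_comm, ← mul_assoc]
  rw [Finset.sum_congr rfl fun l _ => this l, ← map_sum, ← Finset.sum_mul, hk, one_mul,
    hγ.trace_eq_one]

theorem IsPOVM.map_id {X : Type*} [Fintype X] {M : X → V →ₗ[ℂ] V} (hM : IsPOVM M) :
    IsPOVM fun x => TensorProduct.map (M x) (LinearMap.id : K →ₗ[ℂ] K) := by
  refine ⟨fun x => isPositive_map (hM.isPositive x) LinearMap.isPositive_id, ?_⟩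
  rw [← map_sum_left, hM.sum_eq_one]
  exact TensorProduct.map_id

theorem IsPOVM.compress {X : Type*} [Fintype X] {M : X → V →ₗ[ℂ] V} (hM : IsPOVM M)
    (J : W →ₗᵢ[ℂ] V) :
    IsPOVM fun x => LinearMap.adjoint J.toLinearMap ∘ₗ M x ∘ₗ J.toLinearMap := by
  refine ⟨fun x => (hM.isPositive x).adjoint_conj _, ?_⟩
  have : ∑ x, LinearMap.adjoint J.toLinearMap ∘ₗ M x ∘ₗ J.toLinearMap =
      LinearMap.adjoint J.toLinearMap ∘ₗ (∑ x, M x) ∘ₗ J.toLinearMap := by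
    ext v
    simp [LinearMap.sum_apply]
  rw [this, hM.sum_eq_one]
  exact J.adjoint_comp_self'

end Slices

/-- Operators on the traced factor move cyclically under `Tr_V`, so the two copies of `√R` merge
into `R`. The operator `F` acts on the other factor and comes out of the trace. -/
theorem traceLeft_map_opSqrt {V W : Type*}
    [NormedAddCommGroup V] [InnerProductSpace ℂ V] [FiniteDimensional ℂ V]
    [NormedAddCommGroup W] [InnerProductSpace ℂ W] [FiniteDimensional ℂ W]
    {R : V →ₗ[ℂ] V} (hR : R.IsPositive) (F : W →ₗ[ℂ] W) (γ : V ⊗[ℂ] W →ₗ[ℂ] V ⊗[ℂ] W) :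
    traceLeft (TensorProduct.map (opSqrt R) F * γ * TensorProduct.map (opSqrt R) F) =
      F * traceLeft (TensorProduct.map R (1 : W →ₗ[ℂ] W) * γ) * F := by
  have h1 : TensorProduct.map (opSqrt R) F = TensorProduct.map (1 : V →ₗ[ℂ] V) F *
      TensorProduct.map (opSqrt R) (1 : W →ₗ[ℂ] W) := by
    rw [← TensorProduct.map_mul, one_mul, mul_one]
  have h2 : TensorProduct.map (opSqrt R) F = TensorProduct.map (opSqrt R) (1 : W →ₗ[ℂ] W) *
      TensorProduct.map (1 : V →ₗ[ℂ] V) F := by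
    rw [← TensorProduct.map_mul, one_mul, mul_one]
  have h3 := traceLeft_map_one_mul_comm (W := W) (opSqrt R)
    (TensorProduct.map (opSqrt R) (1 : W →ₗ[ℂ] W) * γ)
  rw [← mul_assoc, ← TensorProduct.map_mul, opSqrt_mul_self hR, mul_one] at h3
  calc traceLeft (TensorProduct.map (opSqrt R) F * γ * TensorProduct.map (opSqrt R) F)
      = traceLeft (TensorProduct.map (1 : V →ₗ[ℂ] V) F *
          ((TensorProduct.map (opSqrt R) (1 : W →ₗ[ℂ] W) * γ *
            TensorProduct.map (opSqrt R) (1 : W →ₗ[ℂ] W)) *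
          TensorProduct.map (1 : V →ₗ[ℂ] V) F)) := by
        conv_lhs => rw [h1]
        conv_lhs => enter [2, 2]; rw [← h1, h2]
        simp only [mul_assoc]
    _ = F * (traceLeft (TensorProduct.map (opSqrt R) (1 : W →ₗ[ℂ] W) * γ *
            TensorProduct.map (opSqrt R) (1 : W →ₗ[ℂ] W)) * F) :=
        traceLeft_map_id_comp_comp F F _
    _ = _ := by rw [← h3, mul_assoc]

/-! ### Compressing a state to the support of its reduced state. -/

section Compression

variable {V W W' : Type*}
  [NormedAddCommGroup V] [InnerProductSpace ℂ V] [FiniteDimensional ℂ V]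
  [NormedAddCommGroup W] [InnerProductSpace ℂ W] [FiniteDimensional ℂ W]
  [NormedAddCommGroup W'] [InnerProductSpace ℂ W'] [FiniteDimensional ℂ W']

/-- A projection on the right factor fixes a positive operator when it fixes its partial trace. -/
theorem map_one_mul_eq_of_traceLeft {γ : V ⊗[ℂ] W →ₗ[ℂ] V ⊗[ℂ] W} (hγ : γ.IsPositive)
    {Q : W →ₗ[ℂ] W} (hQ : Q * traceLeft γ = traceLeft γ) :
    TensorProduct.map (1 : V →ₗ[ℂ] V) Q * γ = γ := by
  -- Conjugating `γ` by `1 ⊗ (1 - Q)` gives partial trace `(1 - Q) (Tr γ) (1 - Q)⋆ = 0`, so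
  -- positivity forces `1 ⊗ (1 - Q)` to annihilate `γ`.
  have h0 : TensorProduct.map (1 : V →ₗ[ℂ] V) (1 - Q) * γ = 0 := by
    refine mul_eq_zero_of_traceLeft hγ ?_
    rw [star_map, star_one]
    refine (traceLeft_map_id_comp_comp (1 - Q) (star (1 - Q)) γ).trans ?_
    have h3 : (1 - Q) * traceLeft γ = 0 := by
      rw [sub_mul, one_mul, hQ, sub_self]
    exact (congrArg (· * star (1 - Q)) h3).trans (zero_mul _)
  have h4 : TensorProduct.map (1 : V →ₗ[ℂ] V) (1 : W →ₗ[ℂ] W) =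
      TensorProduct.map (1 : V →ₗ[ℂ] V) (1 - Q) + TensorProduct.map (1 : V →ₗ[ℂ] V) Q := by
    rw [← TensorProduct.map_add_right, sub_add_cancel]
  have h5 := congrArg (· * γ) h4
  simp only [add_mul, h0, zero_add, TensorProduct.map_one, one_mul] at h5
  exact h5.symm

theorem map_id_comp_map_id_comp_eq {γ : V ⊗[ℂ] W →ₗ[ℂ] V ⊗[ℂ] W} (hγ : γ.IsPositive)
    {F : W' →ₗ[ℂ] W} {G : W →ₗ[ℂ] W'} (h : F ∘ₗ G ∘ₗ traceLeft γ = traceLeft γ) :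
    TensorProduct.map (LinearMap.id : V →ₗ[ℂ] V) F ∘ₗ
      TensorProduct.map (LinearMap.id : V →ₗ[ℂ] V) G ∘ₗ γ = γ := by
  rw [← LinearMap.comp_assoc, ← TensorProduct.map_comp, LinearMap.id_comp]
  exact map_one_mul_eq_of_traceLeft hγ (Q := F ∘ₗ G) h

theorem traceLeft_map_conj (R : V →ₗ[ℂ] V) (F : W' →ₗ[ℂ] W) (G : W →ₗ[ℂ] W')
    (γ : V ⊗[ℂ] W' →ₗ[ℂ] V ⊗[ℂ] W') :
    traceLeft (TensorProduct.map R (LinearMap.id : W →ₗ[ℂ] W) ∘ₗ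
      (TensorProduct.map (LinearMap.id : V →ₗ[ℂ] V) F ∘ₗ γ ∘ₗ
        TensorProduct.map (LinearMap.id : V →ₗ[ℂ] V) G)) =
      F ∘ₗ traceLeft (TensorProduct.map R (LinearMap.id : W' →ₗ[ℂ] W') ∘ₗ γ) ∘ₗ G := by
  have hc : TensorProduct.map R (LinearMap.id : W →ₗ[ℂ] W) ∘ₗ
      TensorProduct.map (LinearMap.id : V →ₗ[ℂ] V) F =
      TensorProduct.map (LinearMap.id : V →ₗ[ℂ] V) F ∘ₗ
        TensorProduct.map R (LinearMap.id : W' →ₗ[ℂ] W') := by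
    simp only [← TensorProduct.map_comp, LinearMap.id_comp, LinearMap.comp_id]
  rw [← LinearMap.comp_assoc, hc, ← traceLeft_map_id_comp_comp]
  rfl

end Compression

/-! ### Twirls, their dilations, and commutation with the first player. -/

/-- The twirl of an operator on `V ⊗ W` by Kraus operators on `W`. -/
noncomputable def twirl {V W : Type*}
    [NormedAddCommGroup V] [InnerProductSpace ℂ V] [FiniteDimensional ℂ V]
    [NormedAddCommGroup W] [InnerProductSpace ℂ W] [FiniteDimensional ℂ W]
    {n : ℕ} (k : Fin n → W →ₗ[ℂ] W)
    (γ : V ⊗[ℂ] W →ₗ[ℂ] V ⊗[ℂ] W) : V ⊗[ℂ] W →ₗ[ℂ] V ⊗[ℂ] W :=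
  ∑ l, TensorProduct.map (1 : V →ₗ[ℂ] V) (k l) * γ * TensorProduct.map (1 : V →ₗ[ℂ] V) (star (k l))

theorem IsDensity.twirl {V W : Type*}
    [NormedAddCommGroup V] [InnerProductSpace ℂ V] [FiniteDimensional ℂ V]
    [NormedAddCommGroup W] [InnerProductSpace ℂ W] [FiniteDimensional ℂ W]
    {n : ℕ} {k : Fin n → W →ₗ[ℂ] W}
    {γ : V ⊗[ℂ] W →ₗ[ℂ] V ⊗[ℂ] W} (hγ : IsDensity γ) (hk : ∑ l, star (k l) * k l = 1) :
    IsDensity (twirl k γ) := by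
  have hstar : ∀ l, star (TensorProduct.map (1 : V →ₗ[ℂ] V) (k l)) =
      TensorProduct.map (1 : V →ₗ[ℂ] V) (star (k l)) := fun l => by rw [star_map, star_one]
  have h := IsDensity.sum_kraus hγ (k := fun l => TensorProduct.map (1 : V →ₗ[ℂ] V) (k l)) (by
    simp only [hstar]
    have h2 : ∀ l, TensorProduct.map (1 : V →ₗ[ℂ] V) (star (k l)) *
        TensorProduct.map (1 : V →ₗ[ℂ] V) (k l) =
        TensorProduct.map (1 : V →ₗ[ℂ] V) (star (k l) * k l) := fun l => by
      rw [← TensorProduct.map_mul, one_mul]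
    refine (Finset.sum_congr rfl fun l _ => h2 l).trans ?_
    rw [← map_sum_right, hk, TensorProduct.map_one])
  simp only [hstar] at h
  exact h

section Dilation

variable {V W K : Type*}
  [NormedAddCommGroup V] [InnerProductSpace ℂ V] [FiniteDimensional ℂ V]
  [NormedAddCommGroup W] [InnerProductSpace ℂ W] [FiniteDimensional ℂ W]
  [NormedAddCommGroup K] [InnerProductSpace ℂ K] [FiniteDimensional ℂ K]

theorem assoc_symm_comp_map_krausMap {n : ℕ} (k : Fin n → W →ₗ[ℂ] W) (e : Fin n → K) :
    (TensorProduct.assoc ℂ V W K).symm.toLinearMap ∘ₗ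
      TensorProduct.map (LinearMap.id : V →ₗ[ℂ] V) (krausMap k e) =
      ∑ l, tensorVec (e l) ∘ₗ TensorProduct.map (1 : V →ₗ[ℂ] V) (k l) := by
  refine TensorProduct.ext' fun d w => ?_
  simp [krausMap, LinearMap.sum_apply, TensorProduct.tmul_sum]

theorem map_adjoint_krausMap_comp_assoc {n : ℕ} (k : Fin n → W →ₗ[ℂ] W) (e : Fin n → K) :
    TensorProduct.map (LinearMap.id : V →ₗ[ℂ] V) (LinearMap.adjoint (krausMap k e)) ∘ₗ
      (TensorProduct.assoc ℂ V W K).toLinearMap =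
      ∑ l, TensorProduct.map (1 : V →ₗ[ℂ] V) (star (k l)) ∘ₗ contractVec (e l) := by
  rw [adjoint_krausMap]
  refine TensorProduct.ext_threefold fun d w u => ?_
  simp [LinearMap.sum_apply, TensorProduct.tmul_sum, TensorProduct.smul_tmul']

/-- Tracing out the environment of a dilation gives the twirl. -/
theorem traceRight_dilation {n : ℕ} {k : Fin n → W →ₗ[ℂ] W} {e : Fin n → K}
    (he : Orthonormal ℂ e) (γ : V ⊗[ℂ] W →ₗ[ℂ] V ⊗[ℂ] W) :
    traceRight ((TensorProduct.assoc ℂ V W K).symm.toLinearMap ∘ₗ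
      (TensorProduct.map (LinearMap.id : V →ₗ[ℂ] V) (krausMap k e) ∘ₗ γ ∘ₗ
        TensorProduct.map (LinearMap.id : V →ₗ[ℂ] V) (LinearMap.adjoint (krausMap k e))) ∘ₗ
      (TensorProduct.assoc ℂ V W K).toLinearMap) = twirl k γ := by
  have h1 : (TensorProduct.assoc ℂ V W K).symm.toLinearMap ∘ₗ
      (TensorProduct.map (LinearMap.id : V →ₗ[ℂ] V) (krausMap k e) ∘ₗ γ ∘ₗ
        TensorProduct.map (LinearMap.id : V →ₗ[ℂ] V) (LinearMap.adjoint (krausMap k e))) ∘ₗ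
      (TensorProduct.assoc ℂ V W K).toLinearMap =
      ∑ l, ∑ l', tensorVec (e l) ∘ₗ (TensorProduct.map (1 : V →ₗ[ℂ] V) (k l) ∘ₗ γ ∘ₗ
        TensorProduct.map (1 : V →ₗ[ℂ] V) (star (k l'))) ∘ₗ contractVec (e l') := by
    have h2 : ∀ (F : V ⊗[ℂ] (W ⊗[ℂ] K) →ₗ[ℂ] (V ⊗[ℂ] W) ⊗[ℂ] K)
        (G : (V ⊗[ℂ] W) ⊗[ℂ] K →ₗ[ℂ] V ⊗[ℂ] (W ⊗[ℂ] K))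
        (M : V ⊗[ℂ] W →ₗ[ℂ] V ⊗[ℂ] (W ⊗[ℂ] K)) (N : V ⊗[ℂ] (W ⊗[ℂ] K) →ₗ[ℂ] V ⊗[ℂ] W),
        F ∘ₗ (M ∘ₗ γ ∘ₗ N) ∘ₗ G = (F ∘ₗ M) ∘ₗ γ ∘ₗ (N ∘ₗ G) := fun _ _ _ _ => rfl
    rw [h2, assoc_symm_comp_map_krausMap, map_adjoint_krausMap_comp_assoc]
    refine LinearMap.ext fun z => ?_
    simp only [LinearMap.comp_apply, LinearMap.sum_apply, map_sum]
    exact Finset.sum_comm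
  -- Tracing out the ancilla gives the `(l, l')` term the factor `⟨e l', e l⟩`, so only the diagonal
  -- survives.
  rw [h1]
  simp only [map_sum, traceRight_tensorVec_contractVec, orthonormal_iff_ite.1 he, ite_smul,
    one_smul, zero_smul, Finset.sum_ite_eq', Finset.mem_univ, if_true]
  rfl

end Dilation

/-- On `γ`, the operator `R ⊗ 1` can be traded for `1 ⊗ P`, which the Kraus operators absorb through
`m`. Multiplication on the left gives `∑ m j i • k j γ k i⋆`, on the right `∑ m i j • k i γ k j⋆`;
Hermiticity of `m` is what brings the second to this form, and the two agree after exchanging the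
indices. -/
theorem commute_twirl {V W : Type*}
    [NormedAddCommGroup V] [InnerProductSpace ℂ V] [FiniteDimensional ℂ V]
    [NormedAddCommGroup W] [InnerProductSpace ℂ W] [FiniteDimensional ℂ W]
    {n : ℕ} {k : Fin n → W →ₗ[ℂ] W} {P : W →ₗ[ℂ] W} {m : Fin n → Fin n → ℂ}
    (hP : star P = P) (hm : ∀ i j, star (m i j) = m j i) (hkP : ∀ i, k i * P = ∑ j, m j i • k j)
    {γ : V ⊗[ℂ] W →ₗ[ℂ] V ⊗[ℂ] W} {R : V →ₗ[ℂ] V}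
    (h1 : TensorProduct.map R (1 : W →ₗ[ℂ] W) * γ = TensorProduct.map (1 : V →ₗ[ℂ] V) P * γ)
    (h2 : γ * TensorProduct.map R (1 : W →ₗ[ℂ] W) = γ * TensorProduct.map (1 : V →ₗ[ℂ] V) P) :
    Commute (twirl k γ) (TensorProduct.map R (1 : W →ₗ[ℂ] W)) := by
  have hPk : ∀ i, P * star (k i) = ∑ j, m i j • star (k j) := fun i => by
    have := congrArg star (hkP i)
    rw [star_mul, hP, star_sum] at this
    simpa only [star_smul, hm] using this
  have hR : ∀ F : W →ₗ[ℂ] W, TensorProduct.map R (1 : W →ₗ[ℂ] W) *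
      TensorProduct.map (1 : V →ₗ[ℂ] V) F = TensorProduct.map (1 : V →ₗ[ℂ] V) F *
      TensorProduct.map R (1 : W →ₗ[ℂ] W) := fun F => by
    simp only [← TensorProduct.map_mul, one_mul, mul_one]
  change twirl k γ * _ = _ * twirl k γ
  have hl : ∀ i, TensorProduct.map R (1 : W →ₗ[ℂ] W) *
      (TensorProduct.map (1 : V →ₗ[ℂ] V) (k i) * γ *
        TensorProduct.map (1 : V →ₗ[ℂ] V) (star (k i))) =
      ∑ j, m j i • (TensorProduct.map (1 : V →ₗ[ℂ] V) (k j) * γ *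
        TensorProduct.map (1 : V →ₗ[ℂ] V) (star (k i))) := fun i => by
    rw [← mul_assoc, ← mul_assoc, hR, mul_assoc (TensorProduct.map 1 (k i)), h1, ← mul_assoc,
      ← TensorProduct.map_mul, hkP, one_mul, map_sum_right, Finset.sum_mul, Finset.sum_mul]
    simp only [TensorProduct.map_smul_right, smul_mul_assoc]
  have hr : ∀ i, TensorProduct.map (1 : V →ₗ[ℂ] V) (k i) * γ *
        TensorProduct.map (1 : V →ₗ[ℂ] V) (star (k i)) * TensorProduct.map R (1 : W →ₗ[ℂ] W) =
      ∑ j, m i j • (TensorProduct.map (1 : V →ₗ[ℂ] V) (k i) * γ *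
        TensorProduct.map (1 : V →ₗ[ℂ] V) (star (k j))) := fun i => by
    rw [mul_assoc, ← hR, ← mul_assoc, mul_assoc (TensorProduct.map 1 (k i)), h2, mul_assoc,
      mul_assoc, ← TensorProduct.map_mul, hPk, one_mul, map_sum_right, Finset.mul_sum,
      Finset.mul_sum]
    simp only [TensorProduct.map_smul_right, mul_smul_comm, mul_assoc]
  unfold twirl
  rw [Finset.sum_mul, Finset.mul_sum, Finset.sum_congr rfl fun i _ => hl i,
    Finset.sum_congr rfl fun i _ => hr i]
  exact Finset.sum_comm

/-! ### Conditional states of the second player and the meaning of perfect guessing. -/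

namespace Strategy

variable {A B X Y : Type*} [Fintype X] [Fintype Y]

/-- The operators `Tr_D [(R_a^x ⊗ I) γ]`. -/
noncomputable def conditionalState (Γ : Strategy.{u, v} A B X Y) (a : A) (x : X) :
    Γ.E →ₗ[ℂ] Γ.E :=
  traceLeft (TensorProduct.map (Γ.R a x) (1 : Γ.E →ₗ[ℂ] Γ.E) * Γ.γ)

theorem conditionalState_isPositive (Γ : Strategy.{u, v} A B X Y) (a : A) (x : X) :
    (Γ.conditionalState a x).IsPositive := by
  have h := traceLeft_map_opSqrt ((Γ.povmR a).isPositive x) (1 : Γ.E →ₗ[ℂ] Γ.E) Γ.γ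
  rw [one_mul, mul_one] at h
  unfold conditionalState
  rw [← h]
  refine traceLeft_isPositive ?_
  have hs : star (TensorProduct.map (opSqrt (Γ.R a x)) (1 : Γ.E →ₗ[ℂ] Γ.E)) =
      TensorProduct.map (opSqrt (Γ.R a x)) (1 : Γ.E →ₗ[ℂ] Γ.E) := by
    rw [star_map, star_opSqrt, star_one]
  have := IsPositive.mul_mul_star Γ.densityγ.isPositive
    (TensorProduct.map (opSqrt (Γ.R a x)) (1 : Γ.E →ₗ[ℂ] Γ.E))
  rwa [hs] at this

theorem secondPlayerState_eq (Γ : Strategy.{u, v} A B X Y) (a : A) (b : B) (x : X) (y : Y) :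
    Γ.secondPlayerState a b x y =
      opSqrt (Γ.S b y) * Γ.conditionalState a x * opSqrt (Γ.S b y) := by
  unfold secondPlayerState
  rw [opSqrt_map ((Γ.povmR a).isPositive x) ((Γ.povmS b).isPositive y)]
  exact traceLeft_map_opSqrt ((Γ.povmR a).isPositive x) _ Γ.γ

theorem sum_conditionalState (Γ : Strategy.{u, v} A B X Y) (a : A) :
    ∑ x, Γ.conditionalState a x = traceLeft Γ.γ := by
  simp only [conditionalState]
  rw [← map_sum, ← Finset.sum_mul, ← map_sum_left, (Γ.povmR a).sum_eq_one, TensorProduct.map_one,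
    one_mul]

theorem star_S (Γ : Strategy.{u, v} A B X Y) (b : B) (y : Y) : star (Γ.S b y) = Γ.S b y :=
  ((Γ.povmS b).isPositive y).isSelfAdjoint

theorem star_R (Γ : Strategy.{u, v} A B X Y) (a : A) (x : X) : star (Γ.R a x) = Γ.R a x :=
  ((Γ.povmR a).isPositive x).isSelfAdjoint

/-- With `s = √S` and `t x = √(T x)`, the second player state is `(t x s)⋆ (t x s)`. Orthogonal
ranges make the product of two such states vanish, and `mul_star_eq_zero` strips the outer factors
to leave `t x S t x' = 0`. -/
theorem AllowsPerfectGuessing.conditionalState_mul {Γ : Strategy.{u, v} A B X Y}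
    (hΓ : Γ.AllowsPerfectGuessing) (a : A) (b : B) (y : Y) {x x' : X} (h : x ≠ x') :
    Γ.conditionalState a x * Γ.S b y * Γ.conditionalState a x' = 0 := by
  have hT := fun x => opSqrt_mul_self (Γ.conditionalState_isPositive a x)
  have hTs := fun x => star_opSqrt (Γ.conditionalState a x)
  have hS := opSqrt_mul_self ((Γ.povmS b).isPositive y)
  have hSs := star_opSqrt (Γ.S b y)
  set s := opSqrt (Γ.S b y)
  set t : X → Γ.E →ₗ[ℂ] Γ.E := fun x => opSqrt (Γ.conditionalState a x)
  have hρ : ∀ x, star (t x * s) * (t x * s) = Γ.secondPlayerState a b x y := fun x => by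
    rw [secondPlayerState_eq, star_mul, hSs, hTs]
    conv_rhs => rw [← hT x]
    simp only [mul_assoc]
    rfl
  have hzero : Γ.secondPlayerState a b x y * Γ.secondPlayerState a b x' y = 0 := by
    have hsa : star (Γ.secondPlayerState a b x y) = Γ.secondPlayerState a b x y := by
      rw [← hρ, star_mul, star_star]
    ext v
    refine ext_inner_left ℂ fun w => ?_
    have h1 := (Submodule.isOrtho_iff_inner_eq.1 (hΓ a b y x x' h))
      (Γ.secondPlayerState a b x y w) ⟨w, rfl⟩ (Γ.secondPlayerState a b x' y v) ⟨v, rfl⟩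
    rw [← LinearMap.adjoint_inner_right] at h1
    rw [← LinearMap.star_eq_adjoint, hsa] at h1
    simpa using h1
  rw [← hρ, ← hρ] at hzero
  have h2 := mul_star_eq_zero hzero
  rw [star_mul, hSs, hTs, mul_assoc, ← mul_assoc s, hS] at h2
  calc Γ.conditionalState a x * Γ.S b y * Γ.conditionalState a x'
      = t x * (t x * (Γ.S b y * t x')) * t x' := by
        rw [← hT x, ← hT x']
        simp only [mul_assoc]
        rfl
    _ = 0 := by rw [h2, mul_zero, zero_mul]

/-! ### Restriction to the support of the second player's reduced state. -/

/-- The restriction of a strategy to a subspace of the second player's space supporting the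
state. -/
noncomputable def restrictSnd (Γ : Strategy.{u, v} A B X Y) (U : Submodule ℂ Γ.E)
    (h : U.subtypeₗᵢ.toLinearMap ∘ₗ LinearMap.adjoint U.subtypeₗᵢ.toLinearMap ∘ₗ traceLeft Γ.γ =
      traceLeft Γ.γ) : Strategy.{u, v} A B X Y where
  D := Γ.D
  E := U
  R := Γ.R
  S b y := LinearMap.adjoint U.subtypeₗᵢ.toLinearMap ∘ₗ Γ.S b y ∘ₗ U.subtypeₗᵢ.toLinearMap
  γ := TensorProduct.map LinearMap.id (LinearMap.adjoint U.subtypeₗᵢ.toLinearMap) ∘ₗ Γ.γ ∘ₗ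
    TensorProduct.map LinearMap.id U.subtypeₗᵢ.toLinearMap
  povmR := Γ.povmR
  povmS b := (Γ.povmS b).compress U.subtypeₗᵢ
  densityγ := IsDensity.conj_adjoint_of_comp_eq Γ.densityγ (adjoint_map_id _)
    (map_id_comp_map_id_comp_eq Γ.densityγ.isPositive h)

section RestrictSnd

variable (Γ : Strategy.{u, v} A B X Y) (U : Submodule ℂ Γ.E)
    (h : U.subtypeₗᵢ.toLinearMap ∘ₗ LinearMap.adjoint U.subtypeₗᵢ.toLinearMap ∘ₗ traceLeft Γ.γ =
      traceLeft Γ.γ)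

theorem restrictSnd_γ : Γ.γ = TensorProduct.map LinearMap.id U.subtypeₗᵢ.toLinearMap ∘ₗ
    (Γ.restrictSnd U h).γ ∘ₗ
      TensorProduct.map LinearMap.id (LinearMap.adjoint U.subtypeₗᵢ.toLinearMap) :=
  (conj_adjoint_of_comp_eq Γ.densityγ.isPositive (adjoint_map_id _)
    (map_id_comp_map_id_comp_eq Γ.densityγ.isPositive h)).symm

theorem restrictSnd_embeds : Embeds (Γ.restrictSnd U h) Γ := by
  refine ⟨LinearIsometry.id, U.subtypeₗᵢ, (Γ.restrictSnd_γ U h).trans ?_, fun a x => ?_,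
    fun b y => rfl⟩
  · exact congrArg (fun F => TensorProduct.map LinearMap.id U.subtypeₗᵢ.toLinearMap ∘ₗ
      (Γ.restrictSnd U h).γ ∘ₗ F) (adjoint_map_id U.subtypeₗᵢ.toLinearMap).symm
  · exact (congrArg (fun f => f ∘ₗ Γ.R a x) (LinearMap.adjoint_id (𝕜 := ℂ) (E := Γ.D))).symm

theorem restrictSnd_traceLeft : traceLeft (Γ.restrictSnd U h).γ =
    LinearMap.adjoint U.subtypeₗᵢ.toLinearMap ∘ₗ traceLeft Γ.γ ∘ₗ U.subtypeₗᵢ.toLinearMap :=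
  traceLeft_map_id_comp_comp _ _ _

theorem restrictSnd_conditionalState (a : A) (x : X) : Γ.conditionalState a x =
    U.subtypeₗᵢ.toLinearMap ∘ₗ (Γ.restrictSnd U h).conditionalState a x ∘ₗ
      LinearMap.adjoint U.subtypeₗᵢ.toLinearMap := by
  refine Eq.trans ?_ (traceLeft_map_conj (Γ.R a x) _ _ (Γ.restrictSnd U h).γ)
  exact congrArg (fun M => traceLeft (TensorProduct.map (Γ.R a x) LinearMap.id ∘ₗ M))
    (Γ.restrictSnd_γ U h)

end RestrictSnd

/-- Every strategy contains one in which the second player's reduced state is invertible. -/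
theorem exists_embeds_injective (Γ : Strategy.{u, v} A B X Y) :
    ∃ Γ' : Strategy.{u, v} A B X Y, Embeds Γ' Γ ∧ Function.Injective (traceLeft Γ'.γ) ∧
      ∃ J : Γ'.E →ₗᵢ[ℂ] Γ.E,
        (∀ b y, Γ'.S b y = LinearMap.adjoint J.toLinearMap ∘ₗ Γ.S b y ∘ₗ J.toLinearMap) ∧
        ∀ a x, Γ.conditionalState a x =
          J.toLinearMap ∘ₗ Γ'.conditionalState a x ∘ₗ LinearMap.adjoint J.toLinearMap := by
  set σ := traceLeft Γ.γ with hσ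
  have hσpos : σ.IsPositive := traceLeft_isPositive Γ.densityγ.isPositive
  have hJσ : (LinearMap.range σ).subtypeₗᵢ.toLinearMap ∘ₗ
      LinearMap.adjoint (LinearMap.range σ).subtypeₗᵢ.toLinearMap ∘ₗ σ = σ := by
    ext v
    have h1 : σ v = (LinearMap.range σ).subtypeₗᵢ.toLinearMap ⟨σ v, v, rfl⟩ := rfl
    have h2 := congrArg (fun f => f ⟨σ v, v, rfl⟩)
      (LinearMap.range σ).subtypeₗᵢ.adjoint_comp_self'
    simp only [LinearMap.comp_apply, LinearMap.id_apply] at h2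
    rw [LinearMap.comp_apply, LinearMap.comp_apply, h1, h2]
  refine ⟨Γ.restrictSnd _ hJσ, Γ.restrictSnd_embeds _ hJσ, ?_, (LinearMap.range σ).subtypeₗᵢ,
    fun _ _ => rfl, Γ.restrictSnd_conditionalState _ hJσ⟩
  rw [restrictSnd_traceLeft, ← hσ]
  refine (injective_iff_map_eq_zero _).2 ?_
  rintro ⟨_, w, rfl⟩ hv
  -- The compressed state sends `σ w` to `J⋆ σ (σ w)`, and `J J⋆` fixes the range of `σ`. Symmetry
  -- of `σ` then gives `‖σ w‖² = ⟨w, σ (σ w)⟩ = 0`.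
  have h1 : σ (σ w) = 0 := by
    have h2 := congrArg (LinearMap.range σ).subtypeₗᵢ.toLinearMap hv
    exact (congrArg (fun f : Γ.E →ₗ[ℂ] Γ.E => f (σ w)) hJσ).symm.trans
      (h2.trans (LinearMap.map_zero _))
  have h2 : inner ℂ (σ w) (σ w) = 0 := by
    rw [hσpos.isSymmetric, h1, inner_zero_right]
  exact Subtype.ext (inner_self_eq_zero.1 h2)

/-! ### Twirling a strategy within its congruence class, and the conclusion. -/

/-- The strategy with the same measurements and a different state. -/
noncomputable def withState (Γ : Strategy.{u, v} A B X Y)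
    (γ : Γ.D ⊗[ℂ] Γ.E →ₗ[ℂ] Γ.D ⊗[ℂ] Γ.E) (hγ : IsDensity γ) : Strategy.{u, v} A B X Y :=
  { Γ with γ := γ, densityγ := hγ }

/-- The dilation of a strategy by Kraus operators on the second player's side. -/
noncomputable def dilateSnd (Γ : Strategy.{u, v} A B X Y) {K : Type v} [NormedAddCommGroup K]
    [InnerProductSpace ℂ K] [FiniteDimensional ℂ K] {n : ℕ} {k : Fin n → Γ.E →ₗ[ℂ] Γ.E}
    {e : Fin n → K} (he : Orthonormal ℂ e) (hk : ∑ l, star (k l) * k l = 1) :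
    Strategy.{u, v} A B X Y where
  D := Γ.D
  E := Γ.E ⊗[ℂ] K
  R := Γ.R
  S b y := TensorProduct.map (Γ.S b y) LinearMap.id
  γ := TensorProduct.map LinearMap.id (krausMap k e) ∘ₗ Γ.γ ∘ₗ
    TensorProduct.map LinearMap.id (LinearMap.adjoint (krausMap k e))
  povmR := Γ.povmR
  povmS b := (Γ.povmS b).map_id
  densityγ := IsDensity.conj_isometry Γ.densityγ (adjoint_map_id _) (by
    rw [← TensorProduct.map_comp, LinearMap.id_comp]
    exact (congrArg _ (krausIsometry he hk).adjoint_comp_self').trans TensorProduct.map_id)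

/-- The Kraus isometry embeds the strategy into one with measurements `S ⊗ 1`, as the Kraus
operators commute with `S`; discarding the ancilla restores `S` and leaves the twirled state. -/
theorem congruent_twirl (Γ : Strategy.{u, v} A B X Y) {n : ℕ} {k : Fin n → Γ.E →ₗ[ℂ] Γ.E}
    (hk : ∑ l, star (k l) * k l = 1) (hS : ∀ l b y, Commute (k l) (Γ.S b y)) :
    Congruent Γ (Γ.withState (twirl k Γ.γ) (IsDensity.twirl Γ.densityγ hk)) := by
  -- `ULift` puts the ancilla in the universe of `Γ.E`, as `IsPartialTraceSnd` demands.
  let e : Fin n → EuclideanSpace ℂ (ULift.{v} (Fin n)) :=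
    fun l => EuclideanSpace.single (ULift.up l) (1 : ℂ)
  have he : Orthonormal ℂ e :=
    (EuclideanSpace.orthonormal_single).comp ULift.up ULift.up_injective
  have h1 : Embeds Γ (Γ.dilateSnd he hk) := by
    refine ⟨LinearIsometry.id, krausIsometry he hk, ?_, fun a x => ?_, fun b y => ?_⟩
    · exact congrArg (fun F => TensorProduct.map LinearMap.id (krausMap k e) ∘ₗ Γ.γ ∘ₗ F)
        (adjoint_map_id (krausMap k e)).symm
    · exact (congrArg (fun f => f ∘ₗ Γ.R a x) (LinearMap.adjoint_id (𝕜 := ℂ) (E := Γ.D))).symm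
    · exact (adjoint_krausMap_comp he hk fun l => hS l b y).symm
  refine .trans _ (Γ.dilateSnd he hk) _ (.rel _ _ (Or.inl h1)) (.rel _ _ (Or.inr (Or.inr ?_)))
  refine ⟨EuclideanSpace ℂ (ULift.{v} (Fin n)), inferInstance, inferInstance, inferInstance,
    LinearIsometryEquiv.refl ℂ Γ.D, LinearIsometryEquiv.refl ℂ _, fun _ _ => rfl,
    fun _ _ => rfl, ?_⟩
  refine (traceRight_dilation he Γ.γ).symm.trans (congrArg traceRight ?_)
  have h2 : TensorProduct.congr (LinearEquiv.refl ℂ Γ.D)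
      (LinearEquiv.refl ℂ (Γ.E ⊗[ℂ] EuclideanSpace ℂ (ULift.{v} (Fin n)))) ≪≫ₗ
        (TensorProduct.assoc ℂ Γ.D Γ.E (EuclideanSpace ℂ (ULift.{v} (Fin n)))).symm =
      (TensorProduct.assoc ℂ Γ.D Γ.E (EuclideanSpace ℂ (ULift.{v} (Fin n)))).symm := by
    rw [TensorProduct.congr_refl_refl, LinearEquiv.refl_trans]
  exact (congrArg (fun α : Γ.D ⊗[ℂ] (Γ.E ⊗[ℂ] EuclideanSpace ℂ (ULift.{v} (Fin n))) ≃ₗ[ℂ]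
    (Γ.D ⊗[ℂ] Γ.E) ⊗[ℂ] EuclideanSpace ℂ (ULift.{v} (Fin n)) =>
      α.conj (Γ.dilateSnd he hk).γ) h2).symm

/-- The projections `P a x` on the second player's side reproduce the first player's measurement on
`γ`. One family of Kraus operators, depending only on the `S b y`, serves all `a` and `x` at once.
-/
theorem essentiallyClassical_of_injective [Nonempty B] (Γ : Strategy.{u, v} A B X Y)
    (hinj : Function.Injective (traceLeft Γ.γ))
    (hTS : ∀ a b y x x', x ≠ x' →
      Γ.conditionalState a x * Γ.S b y * Γ.conditionalState a x' = 0) :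
    Γ.EssentiallyClassical := by
  classical
  have hex : ∀ a, ∃ P : X → Γ.E →ₗ[ℂ] Γ.E, (∀ x, star (P x) = P x) ∧
      (∀ x (i : B × Y), Commute (P x) (Γ.S i.1 i.2)) ∧ ∑ x, P x = 1 ∧
      ∀ x x', x ≠ x' → P x' * Γ.conditionalState a x = 0 := fun a => by
    refine exists_commuting_projections (Γ.conditionalState a)
      (fun x => (Γ.conditionalState_isPositive a x).isSelfAdjoint) ?_ (fun x x' h => ?_)
      (fun i : B × Y => Γ.S i.1 i.2) fun i x x' h => hTS a i.1 i.2 x x' h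
    · rwa [sum_conditionalState]
    -- For a fixed `b`, summing over `y` with `∑ y, S b y = 1` removes the middle factor.
    · obtain ⟨b⟩ := ‹Nonempty B›
      rw [← mul_one (Γ.conditionalState a x), ← (Γ.povmS b).sum_eq_one, Finset.mul_sum,
        Finset.sum_mul]
      exact Finset.sum_eq_zero fun y _ => hTS a b y x x' h
  choose P hPs hPS hPsum hPT using hex
  obtain ⟨n, k, hkS, hk, hkP⟩ := exists_kraus (fun i : B × Y => Γ.S i.1 i.2)
    fun i => Γ.star_S i.1 i.2
  refine ⟨_, congruent_twirl Γ hk fun l b y => hkS l (b, y), fun a x => ?_⟩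
  obtain ⟨m, hm, hkm⟩ := hkP (P a x) (hPs a x) (hPS a x)
  have hγs : star Γ.γ = Γ.γ := Γ.densityγ.isPositive.isSelfAdjoint
  -- Conjugating `γ` by `√R_a^x ⊗ P a x'` leaves the partial trace `P a x' T a x P a x' = 0`.
  have hcross : ∀ x x', x ≠ x' → TensorProduct.map (Γ.R a x) (P a x') * Γ.γ = 0 := by
    intro x x' h
    have h1 : TensorProduct.map (opSqrt (Γ.R a x)) (P a x') * Γ.γ = 0 := by
      refine mul_eq_zero_of_traceLeft Γ.densityγ.isPositive ?_
      rw [star_map, star_opSqrt, hPs, traceLeft_map_opSqrt ((Γ.povmR a).isPositive x)]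
      exact (congrArg (· * P a x') (hPT a x x' h)).trans (zero_mul _)
    have h2 : TensorProduct.map (Γ.R a x) (P a x') =
        TensorProduct.map (opSqrt (Γ.R a x)) (1 : Γ.E →ₗ[ℂ] Γ.E) *
          TensorProduct.map (opSqrt (Γ.R a x)) (P a x') := by
      rw [← TensorProduct.map_mul, opSqrt_mul_self ((Γ.povmR a).isPositive x), one_mul]
    rw [h2, mul_assoc, h1, mul_zero]
  -- Expanding `1 = ∑ x', P a x'` on the left and `1 = ∑ x', R_a^x'` on the right, both sides reduce
  -- to `(R_a^x ⊗ P a x) γ`.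
  have h1 : TensorProduct.map (Γ.R a x) (1 : Γ.E →ₗ[ℂ] Γ.E) * Γ.γ =
      TensorProduct.map (1 : Γ.D →ₗ[ℂ] Γ.D) (P a x) * Γ.γ := by
    rw [← hPsum a, ← (Γ.povmR a).sum_eq_one, map_sum_right, map_sum_left, Finset.sum_mul,
      Finset.sum_mul, Finset.sum_eq_single x, Finset.sum_eq_single x]
    · exact fun x' _ h => hcross x' x h
    · simp
    · exact fun x' _ h => hcross x x' h.symm
    · simp
  have h2 : Γ.γ * TensorProduct.map (Γ.R a x) (1 : Γ.E →ₗ[ℂ] Γ.E) =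
      Γ.γ * TensorProduct.map (1 : Γ.D →ₗ[ℂ] Γ.D) (P a x) := by
    have h3 : ∀ F G : Γ.D ⊗[ℂ] Γ.E →ₗ[ℂ] Γ.D ⊗[ℂ] Γ.E, star (F * G) = star G * star F :=
      fun F G => star_mul F G
    have := congrArg star h1
    rw [h3, h3, hγs, star_map, star_map, star_one, star_one, star_R, hPs] at this
    exact this
  exact commute_twirl (hPs a x) hm hkm h1 h2

end Strategy

end QGame

theorem theorem1 {A B X Y : Type*} [Fintype A] [Fintype B] [Fintype X] [Fintype Y]
    (G : QGame.Game A B X Y) (hG : G.CompleteSupport)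
    (Γ : QGame.Strategy A B X Y) (hΓ : Γ.AllowsPerfectGuessing) :
    Γ.EssentiallyClassical := by
  -- The probabilities sum to one, which an empty sum cannot do.
  have hB : Nonempty B := by
    by_contra h
    rw [not_nonempty_iff] at h
    simpa using G.q_sum
  obtain ⟨Γ', hemb, hinj, J, hJS, hJT⟩ := Γ.exists_embeds_injective
  have hJ : LinearMap.adjoint J.toLinearMap ∘ₗ J.toLinearMap = LinearMap.id :=
    J.adjoint_comp_self'
  have hcancel : ∀ M : Γ.E →ₗ[ℂ] Γ.E, ∀ N : Γ'.E →ₗ[ℂ] Γ'.E,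
      M = J.toLinearMap ∘ₗ N ∘ₗ LinearMap.adjoint J.toLinearMap →
      N = LinearMap.adjoint J.toLinearMap ∘ₗ M ∘ₗ J.toLinearMap := by
    rintro M N rfl
    rw [LinearMap.comp_assoc, LinearMap.comp_assoc, hJ, ← LinearMap.comp_assoc, hJ,
      LinearMap.id_comp, LinearMap.comp_id]
  have hcl : Γ'.EssentiallyClassical := by
    refine Γ'.essentiallyClassical_of_injective hinj fun a b y x x' h => ?_
    have h0 := hΓ.conditionalState_mul a b y h
    -- Since `T = J T' J⋆` and `S' = J⋆ S J`, the product `T S T` for `Γ` is `J (T' S' T') J⋆`, and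
    -- `J⋆ J = 1` recovers the product for `Γ'`.
    refine (hcancel _ _ ?_).trans (?_ : _ ∘ₗ (0 : Γ.E →ₗ[ℂ] Γ.E) ∘ₗ _ = 0)
    · rw [← h0, hJT, hJT, hJS]
      rfl
    · simp
  obtain ⟨Γ'', hcong, hcomm⟩ := hcl
  exact ⟨Γ'', .trans _ _ _ (.symm _ _ (.rel _ _ (Or.inl hemb))) hcong, hcomm⟩
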